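/- Let $K$ be a field and let $\mathcal{A}=\{v_1,\ldots,v_q\}\subset\mathbb{N}^n\setminus\{0\}$ be a finite vector configuration (repetitions among the $v_i$ are allowed) which is homogeneous, i.e. lies on an affine hyperplane of $\mathbb{R}^n$ not containing the origin. Let $K[T]=K[T_1,\ldots,T_q]$, write $T^a=T_1^{a_1}\cdots T_q^{a_q}$ for $a\in\mathbb{N}^q$, and let $$I_\mathcal{A}=\Big(T^a-T^b \;\Big|\; a,b\in\mathbb{N}^q,\ \textstyle\sum_i a_iv_i=\sum_i b_iv_i\Big)\subset K[T]$$ be the toric ideal of $\mathcal{A}$. Let $V\subset\mathbb{Q}^q$ be the kernel of the matrix with columns $v_1,\ldots,v_q$. A circuit of $V$ is a non-zero integral vector $\alpha\in V$ whose support does not properly contain the support of any non-zero vector of $V$ and whose non-zero entries are relatively prime; a circuit of $I_\mathcal{A}$ is a binomial $T^{\alpha_+}-T^{\alpha_-}$, where $\alpha$ is a circuit of $V$ and $\alpha=\alpha_+-\alpha_-$ with $\alpha_+,\alpha_-\in\mathbb{N}^q$ of disjoint support. A non-zero binomial $T^a-T^b$ has a square-free term if $a\in\{0,1\}^q$ or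 $b\in\{0,1\}^q$. If every circuit of $I_\mathcal{A}$ has a square-free term, then $\mathcal{A}$ is normal, i.e. $\mathbb{N}\mathcal{A}=\mathbb{Z}\mathcal{A}\cap\mathbb{R}_+\mathcal{A}$, where $\mathbb{N}\mathcal{A}$, $\mathbb{Z}\mathcal{A}$ and $\mathbb{R}_+\mathcal{A}$ are the submonoid of $\mathbb{Z}^n$, the subgroup of $\mathbb{Z}^n$ and the convex cone in $\mathbb{R}^n$ generated by $\mathcal{A}$; moreover, $I_\mathcal{A}$ is generated by a finite set of circuits of $I_\mathcal{A}$ with a square-free term. -/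

import Mathlib

open MvPolynomial

namespace ToricCircuits

/-- A finite configuration is a family `v 0, …, v (q - 1)` of vectors of `ℤ^n`, the columns of the
matrix `A`. This is the image of an integral vector of `ℤ^n` in `ℝ^n`. -/
def toReal {n : ℕ} (x : Fin n → ℤ) : Fin n → ℝ := fun j => (x j : ℝ)

/-- The configuration lies on an affine hyperplane `{x ∈ ℝ^n | ⟨w, x⟩ = r}`, `w ≠ 0`, that does not
contain the origin (`r ≠ 0`). -/
def IsHomogeneous {n q : ℕ} (v : Fin q → Fin n → ℤ) : Prop :=
  ∃ (w : Fin n → ℝ) (r : ℝ), w ≠ 0 ∧ r ≠ 0 ∧ ∀ i, ∑ j, w j * toReal (v i) j = r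

/-- `ℕA = ℤA ∩ ℝ₊A`; as `ℤA ⊆ ℤ^n`, the equality is stated between subsets of `ℤ^n`. -/
def IsNormal {n q : ℕ} (v : Fin q → Fin n → ℤ) : Prop :=
  (AddSubmonoid.closure (Set.range v) : Set (Fin n → ℤ)) =
    {x | x ∈ AddSubgroup.closure (Set.range v) ∧
      toReal x ∈ PointedCone.hull ℝ (Set.range fun i => toReal (v i))}

/-- The toric ideal of the configuration in `K[T_0, …, T_{q-1}]`. -/
noncomputable def toricIdeal (K : Type*) [Field K] {n q : ℕ} (v : Fin q → Fin n → ℤ) :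
    Ideal (MvPolynomial (Fin q) K) :=
  Ideal.span {f | ∃ a b : Fin q →₀ ℕ,
    ∑ i, a i • v i = ∑ i, b i • v i ∧ f = monomial a 1 - monomial b 1}

/-- The kernel of `A` in `ℚ^q`. -/
def kernel {n q : ℕ} (v : Fin q → Fin n → ℤ) : Set (Fin q → ℚ) :=
  {α | ∀ j, ∑ i, α i * (v i j : ℚ) = 0}

/-- `α` is a circuit of `A`: a non-zero integral vector in the kernel `V` of `A`, such that its
support does not properly contain the support of a non-zero vector of `V`, with relatively prime
non-zero entries (zero entries do not affect the gcd). -/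
def IsCircuit {n q : ℕ} (v : Fin q → Fin n → ℤ) (α : Fin q → ℤ) : Prop :=
  α ≠ 0 ∧ (fun i => (α i : ℚ)) ∈ kernel v ∧
    (∀ β ∈ kernel v, β ≠ 0 → ¬ Function.support β ⊂ Function.support α) ∧
    Finset.univ.gcd α = 1

/-- The exponent vector `α₊`, with entries `max (α i) 0`. -/
noncomputable def posPart {q : ℕ} (α : Fin q → ℤ) : Fin q →₀ ℕ :=
  Finsupp.equivFunOnFinite.symm fun i => (α i).toNat

/-- The exponent vector `α₋`, with entries `max (-α i) 0`. -/
noncomputable def negPart {q : ℕ} (α : Fin q → ℤ) : Fin q →₀ ℕ :=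
  Finsupp.equivFunOnFinite.symm fun i => (-α i).toNat

/-- `f` is a circuit of the toric ideal: `f = T^{α₊} - T^{α₋}` for a circuit `α` of `A`. -/
def IsToricCircuit {K : Type*} [Field K] {n q : ℕ} (v : Fin q → Fin n → ℤ)
    (f : MvPolynomial (Fin q) K) : Prop :=
  ∃ α : Fin q → ℤ, IsCircuit v α ∧ f = monomial (posPart α) 1 - monomial (negPart α) 1

/-- `f` is a non-zero binomial `T^a - T^b` such that `T^a` or `T^b` is square-free. -/
def HasSquarefreeTerm {K : Type*} [Field K] {q : ℕ} (f : MvPolynomial (Fin q) K) : Prop :=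
  f ≠ 0 ∧ ∃ a b : Fin q →₀ ℕ, f = monomial a 1 - monomial b 1 ∧
    ((∀ i, a i ≤ 1) ∨ (∀ i, b i ≤ 1))

end ToricCircuits

/-! Every non-zero kernel vector has a circuit `c` conformal to it, i.e. with compatible signs and
no new support (`exists_conformal_circuit`). By hypothesis the positive entries of `c` are all 1 or
its negative entries are all -1 (`squarefree_side`).

Generation: for `a`, `b` of equal degree, take `c` conformal to `a - b`. Then `c₊` is supported in
`a` and `c₋` in `b`, so a square-free side divides its monomial. Swapping it for the other side of
`c` gives a monomial sharing a variable with the opposite end; cancel that variable and induct on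
the degree (`binomial_mem_of_circuits_mem`).

Normality: among the column bases `S` whose cone contains `x`, take one with maximal lattice `ℤS`.
If `v i ∉ ℤS`, a circuit on `S ∪ {i}` has entry at least 2 at `i`, so its negative entries are all
-1. Exchanging `i` for a suitable column with entry -1 keeps `x` in the cone and strictly enlarges
the lattice, a contradiction (`exists_unimodular_cone`). Hence `ℤS = ℤA`, and the unique
coefficients of `x` on `S` are both integral and non-negative. -/

namespace ToricCircuits

/-! ### Conformal circuits and square-free sides -/

/-- Moving `β` along a line until a coordinate vanishes, without crossing any coordinate
hyperplane. -/
lemma exists_conformal_elimination {ι F : Type*} [Fintype ι] [Field F] [LinearOrder F]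
    [IsStrictOrderedRing F] (β γ : ι → F) (hγ : γ ≠ 0) (h : ∀ i, β i = 0 → γ i = 0) :
    ∃ t : F, (∀ i, 0 ≤ β i → 0 ≤ β i + t * γ i) ∧ (∀ i, β i ≤ 0 → β i + t * γ i ≤ 0) ∧
      ∃ k, β k ≠ 0 ∧ β k + t * γ k = 0 := by
  classical
  -- Up to replacing `γ` by `-γ`, some coordinate of `β` moves towards zero as `t` grows from 0.
  wlog hs : ∃ k, γ k * β k < 0 generalizing γ
  · obtain ⟨k, hk⟩ := Function.ne_iff.1 hγ
    have hk' : γ k ≠ 0 := hk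
    have hβ : β k ≠ 0 := fun h0 => hk' (h k h0)
    have hpos : 0 < γ k * β k := by
      push Not at hs
      exact lt_of_le_of_ne (hs k) (mul_ne_zero hk' hβ).symm
    obtain ⟨t, h1, h2, h3⟩ := this (-γ) (neg_ne_zero.2 hγ) (fun i hi => by simp [h i hi])
      ⟨k, by simpa using hpos⟩
    refine ⟨-t, ?_, ?_, ?_⟩
    · simpa using h1
    · simpa using h2
    · simpa using h3
  obtain ⟨k₁, hk₁⟩ := hs
  -- The ratio test: the first time at which a coordinate reaches zero.
  obtain ⟨k, hk, hmin⟩ := Finset.exists_min_image (Finset.univ.filter fun k => γ k * β k < 0)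
    (fun k => -β k / γ k) ⟨k₁, by simpa using hk₁⟩
  simp only [Finset.mem_filter, Finset.mem_univ, true_and] at hk hmin
  have hγk : γ k ≠ 0 := by rintro h0; simp [h0] at hk
  have hβk : β k ≠ 0 := by rintro h0; simp [h0] at hk
  have ht : 0 < -β k / γ k := by
    have : -β k / γ k = -(γ k * β k) / (γ k) ^ 2 := by field_simp
    rw [this]
    exact div_pos (by linarith) (by positivity)
  refine ⟨-β k / γ k, ?_, ?_, k, hβk, by field_simp; ring⟩
  · intro i hi
    rcases le_or_gt 0 (γ i) with hg | hg
    · have := mul_nonneg ht.le hg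
      linarith
    · rcases hi.eq_or_lt with h0 | h0
      · rw [h i h0.symm] at hg
        exact absurd hg (lt_irrefl _)
      · have := mul_le_mul_of_nonpos_right (hmin i (mul_neg_of_neg_of_pos hg h0)) hg.le
        rw [div_mul_cancel₀ _ hg.ne] at this
        linarith
  · intro i hi
    rcases le_or_gt (γ i) 0 with hg | hg
    · have := mul_nonpos_of_nonneg_of_nonpos ht.le hg
      linarith
    · rcases hi.eq_or_lt with h0 | h0
      · rw [h i h0] at hg
        exact absurd hg (lt_irrefl _)
      · have := mul_le_mul_of_nonneg_right (hmin i (mul_neg_of_pos_of_neg hg h0)) hg.le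
        rw [div_mul_cancel₀ _ hg.ne'] at this
        linarith

variable {n q : ℕ} {v : Fin q → Fin n → ℤ}

lemma add_smul_mem_kernel {α β : Fin q → ℚ} (hα : α ∈ kernel v) (hβ : β ∈ kernel v) (t : ℚ) :
    (fun i => α i + t * β i) ∈ kernel v := by
  intro j
  simp only [add_mul, Finset.sum_add_distrib, mul_assoc, ← Finset.mul_sum]
  rw [hα j, hβ j]
  simp

lemma smul_mem_kernel {α : Fin q → ℚ} (hα : α ∈ kernel v) (t : ℚ) :
    (fun i => t * α i) ∈ kernel v := by
  intro j
  simp only [mul_assoc, ← Finset.mul_sum]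
  rw [hα j, mul_zero]

lemma intCast_mem_kernel_iff {c : Fin q → ℤ} :
    (fun i => (c i : ℚ)) ∈ kernel v ↔ ∑ i, c i • v i = 0 := by
  constructor
  · intro h
    funext j
    have : ∑ i, (c i : ℚ) * (v i j : ℚ) = 0 := h j
    simp only [Finset.sum_apply, Pi.smul_apply, smul_eq_mul, Pi.zero_apply]
    exact_mod_cast this
  · intro h j
    have := congrFun h j
    simp only [Finset.sum_apply, Pi.smul_apply, smul_eq_mul, Pi.zero_apply] at this
    change ∑ i, (c i : ℚ) * (v i j : ℚ) = 0
    exact_mod_cast this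

/-- Every non-zero rational vector is a positive multiple of a primitive integral vector. -/
lemma exists_primitive_multiple (β : Fin q → ℚ) (hβ : β ≠ 0) :
    ∃ (c : Fin q → ℤ) (s : ℚ), 0 < s ∧ (∀ i, (c i : ℚ) = s * β i) ∧ Finset.univ.gcd c = 1 := by
  obtain ⟨k, hk⟩ := Function.ne_iff.1 hβ
  have hk' : β k ≠ 0 := hk
  obtain ⟨⟨b, hb⟩, hbm⟩ := IsLocalization.exist_integer_multiples_of_finite (nonZeroDivisors ℤ) β
  have hb0 : b ≠ 0 := nonZeroDivisors.ne_zero hb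
  choose m hm using hbm
  have hm' : ∀ i, (m i : ℚ) = b * β i := by
    intro i
    simpa using hm i
  -- The common denominator `b` may be negative; its sign is absorbed so that the scaling factor
  -- `|b| / d` is positive.
  obtain ⟨g, hg, hg1⟩ := Finset.extract_gcd (s := Finset.univ) (fun i => b.sign * m i) ⟨k, by simp⟩
  set d := Finset.univ.gcd (fun i => b.sign * m i) with hd
  have hd0 : d ≠ 0 := by
    intro h0
    have h1 := hg k (by simp)
    simp only [h0, zero_mul, mul_eq_zero, Int.sign_eq_zero_iff_zero, hb0, false_or] at h1
    have h2 := hm' k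
    rw [h1] at h2
    simp [hb0, hk'] at h2
  have hdn : 0 ≤ d := by
    have := Finset.normalize_gcd (s := (Finset.univ : Finset (Fin q)))
      (f := fun i => b.sign * m i)
    rw [← hd] at this
    rw [← this]
    exact Int.nonneg_of_normalize_eq_self (normalize_idem d)
  have hdpos : 0 < d := lt_of_le_of_ne hdn hd0.symm
  have hdq : (0 : ℚ) < d := by exact_mod_cast hdpos
  have habs : (0 : ℚ) < |b| := by exact_mod_cast abs_pos.2 hb0
  refine ⟨g, (|b| : ℤ) / d, by push_cast; positivity, fun i => ?_, hg1⟩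
  have h1 : ((b.sign * m i : ℤ) : ℚ) = (d * g i : ℤ) := by exact_mod_cast hg i (by simp)
  have h2 : ((b.sign * m i : ℤ) : ℚ) = (|b| : ℤ) * β i := by
    rw [← Int.sign_mul_self_eq_abs]
    push_cast
    rw [hm' i, mul_assoc]
  rw [div_mul_eq_mul_div, eq_div_iff hdq.ne', ← h2, h1]
  push_cast
  ring

/-- Every non-zero vector of the kernel dominates, sign by sign, a circuit. -/
lemma exists_conformal_circuit {α : Fin q → ℚ} (hα : α ∈ kernel v) (h0 : α ≠ 0) :
    ∃ c, IsCircuit v c ∧ (∀ i, 0 ≤ α i → 0 ≤ c i) ∧ (∀ i, α i ≤ 0 → c i ≤ 0) := by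
  classical
  obtain ⟨β, ⟨hβ, hβ0, hp, hn⟩, hmin⟩ := exists_minimalFor_of_wellFoundedLT
    (fun β : Fin q → ℚ => β ∈ kernel v ∧ β ≠ 0 ∧ (∀ i, 0 ≤ α i → 0 ≤ β i) ∧
      (∀ i, α i ≤ 0 → β i ≤ 0))
    (fun β => (Finset.univ.filter fun i => β i ≠ 0)) ⟨α, hα, h0, fun _ h => h, fun _ h => h⟩
  obtain ⟨c, s, hs, hc, hgcd⟩ := exists_primitive_multiple β hβ0
  have hsupp : ∀ i, c i = 0 ↔ β i = 0 := by
    intro i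
    rw [← Int.cast_eq_zero (α := ℚ), hc i, mul_eq_zero]
    simp [hs.ne']
  refine ⟨c, ⟨?_, ?_, ?_, hgcd⟩, ?_, ?_⟩
  · rintro rfl
    exact hβ0 (funext fun i => (hsupp i).1 rfl)
  · have : (fun i => (c i : ℚ)) = fun i => s * β i := funext hc
    rw [this]
    exact smul_mem_kernel hβ s
  · intro γ hγ hγ0 hsub
    obtain ⟨hle, hnle⟩ := hsub
    have hz : ∀ i, β i = 0 → γ i = 0 := by
      intro i hi
      by_contra hne
      exact hle hne ((hsupp i).2 hi)
    -- Minimality of `β` is known only among vectors conformal to `α`. Moving along `γ` stays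
    -- conformal and loses the coordinate `k`; the coordinate `l`, outside the support of `γ`, keeps
    -- the result non-zero.
    obtain ⟨t, h1, h2, k, hk, hk0⟩ := exists_conformal_elimination β γ hγ0 hz
    obtain ⟨l, hl, hl'⟩ := Set.not_subset.1 hnle
    have hγl : γ l = 0 := by simpa using hl'
    have hβl : β l ≠ 0 := fun h => hl ((hsupp l).2 h)
    have := hmin (j := fun i => β i + t * γ i)
      ⟨add_smul_mem_kernel hβ hγ t, fun h => hβl (by simpa [hγl] using congrFun h l),
        fun i hi => h1 i (hp i hi), fun i hi => h2 i (hn i hi)⟩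
      (by
        intro i hi
        simp only [Finset.mem_filter, Finset.mem_univ, true_and] at hi ⊢
        intro h
        simp [h, hz i h] at hi)
    have hk1 := this (show k ∈ _ by simpa using hk)
    simp [hk0] at hk1
  · intro i hi
    have : (0 : ℚ) ≤ c i := by rw [hc i]; exact mul_nonneg hs.le (hp i hi)
    exact_mod_cast this
  · intro i hi
    have : (c i : ℚ) ≤ 0 := by rw [hc i]; exact mul_nonpos_of_nonneg_of_nonpos hs.le (hn i hi)
    exact_mod_cast this

/-- Without negative coefficients every term of the relation would vanish coordinatewise. Applied to
`c` and `-c`, this shows that both sides of a circuit are non-trivial. -/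
lemma exists_neg_of_sum_smul_eq_zero (hnonneg : ∀ i j, 0 ≤ v i j) (hne : ∀ i, v i ≠ 0)
    {c : Fin q → ℤ} (hc : ∑ i, c i • v i = 0) (h0 : c ≠ 0) : ∃ k, c k < 0 := by
  by_contra! h
  apply h0
  funext i
  obtain ⟨j, hj⟩ := Function.ne_iff.1 (hne i)
  have hs := congrFun hc j
  simp only [Finset.sum_apply, Pi.smul_apply, smul_eq_mul, Pi.zero_apply] at hs
  have := (Finset.sum_eq_zero_iff_of_nonneg
    (fun i _ => mul_nonneg (h i) (hnonneg i j))).1 hs i (by simp)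
  exact (mul_eq_zero.1 this).resolve_right hj

@[simp] lemma posPart_apply (c : Fin q → ℤ) (i : Fin q) : posPart c i = (c i).toNat := rfl

@[simp] lemma negPart_apply (c : Fin q → ℤ) (i : Fin q) : negPart c i = (-c i).toNat := rfl

lemma squarefree_side {K : Type*} [Field K] {c : Fin q → ℤ}
    (h : HasSquarefreeTerm (monomial (posPart c) (1 : K) - monomial (negPart c) 1)) :
    (∀ i, c i ≤ 1) ∨ (∀ i, -1 ≤ c i) := by
  classical
  obtain ⟨hf, a, b, hab, hsq⟩ := h
  have hne : posPart c ≠ negPart c := fun h => hf (by rw [h, sub_self])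
  -- Comparing coefficients identifies the exponents only as an unordered pair: in characteristic 2
  -- the two terms may be interchanged.
  have hp : posPart c = a ∨ posPart c = b := by
    by_contra! hcon
    have := congrArg (coeff (posPart c)) hab
    simp [coeff_monomial, hne.symm, hcon.1.symm, hcon.2.symm] at this
  have hn : negPart c = a ∨ negPart c = b := by
    by_contra! hcon
    have := congrArg (coeff (negPart c)) hab
    simp [coeff_monomial, hne, hcon.1.symm, hcon.2.symm] at this
  have key : (∀ i, posPart c i ≤ 1) ∨ (∀ i, negPart c i ≤ 1) := by
    rcases hp with rfl | rfl <;> rcases hn with hn | hn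
    · exact absurd hn.symm hne
    · rwa [hn]
    · rw [hn]; exact hsq.symm
    · exact absurd hn.symm hne
  refine key.imp (fun h i => ?_) (fun h i => ?_)
  · have := h i
    simp only [posPart_apply] at this
    omega
  · have := h i
    simp only [negPart_apply] at this
    omega

end ToricCircuits
-- Generation of the toric ideal by circuits
namespace ToricCircuits

variable {n q : ℕ} {v : Fin q → Fin n → ℤ}

/-- A step from `T^a` along a circuit whose positive side is square-free. -/
lemma exists_step {K : Type*} [Field K] {J : Ideal (MvPolynomial (Fin q) K)}
    {c : Fin q → ℤ} (hJ : monomial (posPart c) (1 : K) - monomial (negPart c) 1 ∈ J)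
    (hc : ∑ i, c i • v i = 0) (hsq : ∀ i, c i ≤ 1) (a : Fin q →₀ ℕ)
    (hp : ∀ i, 0 < c i → 0 < a i) :
    ∃ a' : Fin q →₀ ℕ, ∑ i, a' i • v i = ∑ i, a i • v i ∧ (∀ k, c k < 0 → 0 < a' k) ∧
      monomial a (1 : K) - monomial a' 1 ∈ J := by
  have hle : posPart c ≤ a := by
    intro i
    have h1 := hsq i
    have h2 := hp i
    simp only [posPart_apply]
    omega
  refine ⟨(a - posPart c) + negPart c, ?_, ?_, ?_⟩
  · rw [← sub_eq_zero, ← Finset.sum_sub_distrib, ← neg_eq_zero.2 hc, ← Finset.sum_neg_distrib]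
    refine Finset.sum_congr rfl fun i _ => ?_
    have h1 := hle i
    simp only [posPart_apply] at h1
    rw [← natCast_zsmul, ← natCast_zsmul, ← sub_smul, ← neg_smul]
    congr 1
    simp only [Finsupp.add_apply, Finsupp.tsub_apply, posPart_apply, negPart_apply]
    omega
  · intro k hk
    simp only [Finsupp.add_apply, negPart_apply]
    omega
  · have : monomial a (1 : K) - monomial ((a - posPart c) + negPart c) 1 =
        monomial (a - posPart c) 1 * (monomial (posPart c) 1 - monomial (negPart c) 1) := by
      rw [mul_sub, monomial_mul, monomial_mul, tsub_add_cancel_of_le hle, one_mul]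
    rw [this]
    exact J.mul_mem_left _ hJ

lemma binomial_mem_of_circuits_mem {K : Type*} [Field K] (hnonneg : ∀ i j, 0 ≤ v i j)
    (hne : ∀ i, v i ≠ 0) (hsq : ∀ c, IsCircuit v c → (∀ i, c i ≤ 1) ∨ (∀ i, -1 ≤ c i))
    {J : Ideal (MvPolynomial (Fin q) K)}
    (hJ : ∀ c, IsCircuit v c → monomial (posPart c) (1 : K) - monomial (negPart c) 1 ∈ J)
    (a b : Fin q →₀ ℕ) (hab : ∑ i, a i • v i = ∑ i, b i • v i) :
    monomial a (1 : K) - monomial b 1 ∈ J := by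
  classical
  -- The coordinate sum of the degree is a grading in which every variable has positive weight.
  induction hN : (∑ j, (∑ i, a i • v i) j).toNat using Nat.strong_induction_on
    generalizing a b with
  | _ N ih =>
  -- Two monomials of this degree with a common variable `T_k`: divide by it and use induction in
  -- smaller degree.
  have share : ∀ a' b' : Fin q →₀ ℕ, ∀ k, ∑ i, a' i • v i = ∑ i, a i • v i →
      ∑ i, b' i • v i = ∑ i, a i • v i → 0 < a' k → 0 < b' k →
      monomial a' (1 : K) - monomial b' 1 ∈ J := by
    intro a' b' k ha' hb' hak hbk
    have hsplit : ∀ d : Fin q →₀ ℕ, 0 < d k → (d - Finsupp.single k 1) + Finsupp.single k 1 = d :=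
      fun d hd => tsub_add_cancel_of_le (Finsupp.single_le_iff.2 hd)
    have hsum : ∀ d : Fin q →₀ ℕ, 0 < d k →
        ∑ i, d i • v i = ∑ i, (d - Finsupp.single k 1 : Fin q →₀ ℕ) i • v i + v k := by
      intro d hd
      conv_lhs => rw [← hsplit d hd]
      simp only [Finsupp.add_apply, add_smul, Finset.sum_add_distrib]
      congr 1
      rw [Finset.sum_eq_single k (fun i _ hi => by simp [hi.symm])
        (by simp)]
      simp
    set a'' := a' - Finsupp.single k 1
    set b'' := b' - Finsupp.single k 1
    have hlt : (∑ j, (∑ i, a'' i • v i) j).toNat < N := by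
      have h1 : ∑ j, (∑ i, a i • v i) j = ∑ j, (∑ i, a'' i • v i) j + ∑ j, v k j := by
        rw [← ha', hsum a' hak, ← Finset.sum_add_distrib]
        rfl
      have h2 : 0 < ∑ j, v k j := by
        obtain ⟨j, hj⟩ := Function.ne_iff.1 (hne k)
        exact Finset.sum_pos' (fun j _ => hnonneg k j)
          ⟨j, by simp, lt_of_le_of_ne (hnonneg k j) (Ne.symm hj)⟩
      have h3 : 0 ≤ ∑ j, (∑ i, a'' i • v i) j := by
        refine Finset.sum_nonneg fun j _ => ?_
        rw [Finset.sum_apply]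
        exact Finset.sum_nonneg fun i _ => nsmul_nonneg (hnonneg i j) _
      omega
    have hmem := ih _ hlt a'' b'' (by
      have := (hsum a' hak).symm.trans ((ha'.trans hb'.symm).trans (hsum b' hbk))
      exact add_right_cancel this) rfl
    rw [← hsplit a' hak, ← hsplit b' hbk]
    have : monomial (a'' + Finsupp.single k 1) (1 : K) - monomial (b'' + Finsupp.single k 1) 1 =
        monomial (Finsupp.single k 1) 1 * (monomial a'' 1 - monomial b'' 1) := by
      rw [mul_sub, monomial_mul, monomial_mul, one_mul, add_comm a'', add_comm b'']
    rw [this]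
    exact J.mul_mem_left _ hmem
  by_cases heq : a = b
  · simp [heq]
  let d : Fin q → ℤ := fun i => (a i : ℤ) - b i
  have hd : (fun i => (d i : ℚ)) ∈ kernel v := by
    rw [intCast_mem_kernel_iff]
    simp only [d, sub_smul, Finset.sum_sub_distrib, natCast_zsmul]
    rw [hab, sub_self]
  have hd0 : (fun i => (d i : ℚ)) ≠ 0 := by
    intro h
    apply heq
    ext i
    have := congrFun h i
    simp only [Pi.zero_apply, Int.cast_eq_zero, d] at this
    omega
  obtain ⟨c, hc, hcp, hcn⟩ := exists_conformal_circuit hd hd0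
  have hc0 : ∑ i, c i • v i = 0 := intCast_mem_kernel_iff.1 hc.2.1
  have hneg : ∑ i, (-c) i • v i = 0 := by simpa using hc0
  have hpos_a : ∀ i, 0 < c i → 0 < a i := by
    intro i hi
    by_contra h
    have : c i ≤ 0 := hcn i (by simp only [d]; push_cast; simp at h; simp [h])
    omega
  have hneg_b : ∀ i, c i < 0 → 0 < b i := by
    intro i hi
    by_contra h
    have : 0 ≤ c i := hcp i (by simp only [d]; push_cast; simp at h; simp [h])
    omega
  rcases hsq c hc with h | h
  · obtain ⟨k, hk⟩ := exists_neg_of_sum_smul_eq_zero hnonneg hne hc0 hc.1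
    obtain ⟨a', h1, h2, h3⟩ := exists_step (hJ c hc) hc0 h a hpos_a
    have := J.add_mem h3 (share a' b k h1 hab.symm (h2 k hk) (hneg_b k hk))
    simpa using this
  -- The mirror case: `-c` has a square-free positive side, and the step starts from `b`.
  · obtain ⟨k, hk⟩ := exists_neg_of_sum_smul_eq_zero hnonneg hne hneg (neg_ne_zero.2 hc.1)
    have hJ' : monomial (posPart (-c)) (1 : K) - monomial (negPart (-c)) 1 ∈ J := by
      have h1 : posPart (-c) = negPart c := rfl
      have h2 : negPart (-c) = posPart c := by ext i; simp
      rw [h1, h2, ← neg_sub]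
      exact J.neg_mem (hJ c hc)
    obtain ⟨b', h1, h2, h3⟩ := exists_step hJ' hneg (fun i => by have := h i; simp; omega) b
      (fun i hi => hneg_b i (by simpa using hi))
    have := J.sub_mem (share a b' k rfl (h1.trans hab.symm) (hpos_a k (by simpa using hk))
      (h2 k hk)) h3
    simpa using this

/-- If every circuit has a square-free term, the circuits generate the toric ideal. -/
lemma toricIdeal_eq_span_circuits {K : Type*} [Field K] (hnonneg : ∀ i j, 0 ≤ v i j)
    (hne : ∀ i, v i ≠ 0) (hsq : ∀ c, IsCircuit v c → (∀ i, c i ≤ 1) ∨ (∀ i, -1 ≤ c i)) :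
    toricIdeal K v = Ideal.span {f | IsToricCircuit v f} := by
  apply le_antisymm
  · refine Ideal.span_le.2 ?_
    rintro f ⟨a, b, hab, rfl⟩
    exact binomial_mem_of_circuits_mem hnonneg hne hsq
      (fun c hc => Ideal.subset_span (show IsToricCircuit v _ from ⟨c, hc, rfl⟩)) a b hab
  · refine Ideal.span_mono ?_
    rintro f ⟨c, hc, rfl⟩
    refine ⟨posPart c, negPart c, ?_, rfl⟩
    rw [← sub_eq_zero, ← Finset.sum_sub_distrib, ← intCast_mem_kernel_iff.1 hc.2.1]
    refine Finset.sum_congr rfl fun i _ => ?_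
    rw [← natCast_zsmul, ← natCast_zsmul, ← sub_smul]
    congr 1
    simp only [posPart_apply, negPart_apply]
    omega

end ToricCircuits
-- Independent columns, simplicial cones and exchange
namespace ToricCircuits

variable {n q : ℕ} {v : Fin q → Fin n → ℤ}

/-- The columns indexed by `S` are linearly independent over `ℚ`. -/
def ColIndep (v : Fin q → Fin n → ℤ) (S : Finset (Fin q)) : Prop :=
  ∀ β ∈ kernel v, (∀ i ∉ S, β i = 0) → β = 0

/-- Every column is a rational combination of the columns indexed by `S`. -/
def ColSpans (v : Fin q → Fin n → ℤ) (S : Finset (Fin q)) : Prop :=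
  ∀ i ∉ S, ∃ γ ∈ kernel v, γ i = 1 ∧ ∀ j ∉ S, j ≠ i → γ j = 0

/-- `x` is a non-negative real combination of the columns indexed by `S`. -/
def InCone (v : Fin q → Fin n → ℤ) (x : Fin n → ℤ) (S : Finset (Fin q)) : Prop :=
  ∃ l : Fin q → ℝ, (∀ i, 0 ≤ l i) ∧ (∀ i ∉ S, l i = 0) ∧ ∀ j, ∑ i, l i * (v i j : ℝ) = x j

/-- Linear independence over `ℚ` passes to `ℝ`. -/
lemma ColIndep.eq_zero_of_real {S : Finset (Fin q)} (hS : ColIndep v S) {l : Fin q → ℝ}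
    (hl : ∀ i ∉ S, l i = 0) (h : ∀ j, ∑ i, l i * (v i j : ℝ) = 0) : l = 0 := by
  funext k
  -- The `ℚ`-linear functionals `ℝ → ℚ` separate points, and each turns a real relation into a
  -- rational one.
  refine (Module.forall_dual_apply_eq_zero_iff ℚ (l k)).1 fun φ => ?_
  have : (fun i => φ (l i)) = 0 := by
    refine hS _ (fun j => ?_) (fun i hi => by simp [hl i hi])
    have := congrArg φ (h j)
    rw [map_sum, map_zero] at this
    rw [← this]
    refine Finset.sum_congr rfl fun i _ => ?_
    have h1 : l i * (v i j : ℝ) = (v i j : ℚ) • l i := by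
      rw [Rat.smul_def]; push_cast; ring
    rw [h1, map_smul, smul_eq_mul, mul_comm]
  exact congrFun this k

lemma ColIndep.exists_superset_spans {S : Finset (Fin q)} (hS : ColIndep v S) :
    ∃ T, S ⊆ T ∧ ColIndep v T ∧ ColSpans v T := by
  classical
  obtain ⟨T, ⟨hST, hT⟩, hmax⟩ := Set.Finite.exists_maximalFor id
    {T : Finset (Fin q) | S ⊆ T ∧ ColIndep v T} (Set.toFinite _) ⟨S, subset_rfl, hS⟩
  refine ⟨T, hST, hT, fun i hi => ?_⟩
  by_cases hins : ColIndep v (insert i T)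
  · exact absurd (hmax ⟨hST.trans (Finset.subset_insert _ _), hins⟩ (Finset.subset_insert _ _)
      (Finset.mem_insert_self i T)) hi
  · unfold ColIndep at hins
    push Not at hins
    obtain ⟨β, hβ, hβs, hβ0⟩ := hins
    have hβi : β i ≠ 0 := by
      intro h
      refine hβ0 (hT β hβ fun j hj => ?_)
      by_cases hji : j = i
      · rw [hji, h]
      · exact hβs j (by simp [hji, hj])
    exact ⟨_, smul_mem_kernel hβ (β i)⁻¹, inv_mul_cancel₀ hβi,
      fun j hj hji => by simp [hβs j (by simp [hji, hj])]⟩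

/-- Carathéodory's theorem: the coefficients may be supported on independent columns. -/
lemma InCone.exists_indep {x : Fin n → ℤ} {S : Finset (Fin q)} (hx : InCone v x S) :
    ∃ T, ColIndep v T ∧ InCone v x T := by
  classical
  obtain ⟨T, hT, hmin⟩ := Set.Finite.exists_minimalFor id {T | InCone v x T} (Set.toFinite _)
    ⟨S, hx⟩
  refine ⟨T, fun β hβ hβT => ?_, hT⟩
  by_contra hβ0
  obtain ⟨l, hl0, hlT, hlx⟩ := hT
  -- By minimality `l` has no zero on `T`, so `β` vanishes wherever `l` does, as elimination
  -- requires.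
  have hT' : ∀ k ∈ T, l k ≠ 0 := by
    intro k hk h
    have : InCone v x (T.erase k) := by
      refine ⟨l, hl0, fun i hi => ?_, hlx⟩
      by_cases hik : i = k
      · rw [hik, h]
      · exact hlT i (by simpa [hik] using hi)
    have := hmin this (Finset.erase_subset k T) hk
    simp at this
  obtain ⟨t, h1, -, k, hk, hk0⟩ := exists_conformal_elimination l (fun i => (β i : ℝ))
    (fun h => hβ0 (funext fun i => by simpa using congrFun h i))
    (fun i hi => by
      rw [hβT i fun h => hT' i h hi, Rat.cast_zero])
  have hkT : k ∈ T := by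
    by_contra h
    exact hk (hlT k h)
  have : InCone v x (T.erase k) := by
    refine ⟨fun i => l i + t * β i, fun i => h1 i (hl0 i), fun i hi => ?_, fun j => ?_⟩
    · by_cases hik : i = k
      · rw [hik]; exact hk0
      · have hi' : i ∉ T := by simpa [hik] using hi
        simp [hlT i hi', hβT i hi']
    · have hβj : ∑ i, (β i : ℝ) * (v i j : ℝ) = 0 := by
        have := hβ j
        exact_mod_cast this
      simp only [add_mul, Finset.sum_add_distrib, mul_assoc, ← Finset.mul_sum]
      rw [hlx j, hβj]
      simp
  have := hmin this (Finset.erase_subset k T) hkT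
  simp at this

/-- A relation can be solved over `ℤ` for a column with coefficient ±1. It serves for the entering
column (entry 1 is excluded) and for the leaving one (entry -1 loses nothing). -/
lemma mem_span_of_relation {c : Fin q → ℤ} (hc : ∑ i, c i • v i = 0) {T : Finset (Fin q)}
    {k : Fin q} (hk : IsUnit (c k)) (hT : ∀ i ∉ T, i ≠ k → c i = 0) :
    v k ∈ Submodule.span ℤ (v '' T) := by
  classical
  have h1 : c k • v k = -∑ i ∈ Finset.univ.erase k, c i • v i := by
    rw [eq_neg_iff_add_eq_zero, Finset.add_sum_erase _ (fun i => c i • v i) (Finset.mem_univ k), hc]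
  have h2 : c k • v k ∈ Submodule.span ℤ (v '' T) := by
    rw [h1]
    refine Submodule.neg_mem _ (Submodule.sum_mem _ fun i hi => ?_)
    by_cases hiT : i ∈ T
    · exact Submodule.smul_mem _ _ (Submodule.subset_span ⟨i, hiT, rfl⟩)
    · rw [hT i hiT (Finset.ne_of_mem_erase hi), zero_smul]
      exact Submodule.zero_mem _
  exact (Submodule.smul_mem_iff_of_isUnit _ hk).1 h2

/-- Exchanging `k` and `i` along a circuit preserves independence. -/
lemma ColIndep.exchange {S : Finset (Fin q)} (hS : ColIndep v S) {c : Fin q → ℚ}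
    (hc : c ∈ kernel v) {i k : Fin q} (hi : i ∉ S) (hk : k ∈ S) (hci : c i ≠ 0) (hck : c k ≠ 0)
    (hsupp : ∀ j ∉ S, j ≠ i → c j = 0) : ColIndep v (insert i (S.erase k)) := by
  intro β hβ hβs
  have hki : k ≠ i := fun h => hi (h ▸ hk)
  -- Subtracting a multiple of `c` removes column `i` and leaves a relation on `S`, hence zero; its
  -- entry at `k` then gives `β i = 0`.
  have h := hS _ (add_smul_mem_kernel hβ hc (-(β i / c i))) (fun j hj => by
    by_cases hji : j = i
    · subst hji
      field_simp
      ring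
    · simp [hsupp j hj hji, hβs j (by simp [hji, hj])])
  have h1 := congrFun h k
  simp only [hβs k (by simp [hki]), Pi.zero_apply, zero_add, mul_eq_zero, neg_eq_zero,
    div_eq_zero_iff, hci, hck, or_false] at h1
  simpa [h1] using h

lemma ColSpans.exchange {S : Finset (Fin q)} (hS : ColSpans v S) {c : Fin q → ℚ}
    (hc : c ∈ kernel v) {i k : Fin q} (hk : k ∈ S) (hck : c k ≠ 0)
    (hsupp : ∀ j ∉ S, j ≠ i → c j = 0) : ColSpans v (insert i (S.erase k)) := by
  intro m hm
  simp only [Finset.mem_insert, Finset.mem_erase, not_or, not_and] at hm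
  by_cases hmk : m = k
  · subst hmk
    refine ⟨_, smul_mem_kernel hc (c m)⁻¹, inv_mul_cancel₀ hck, fun j hj hjm => ?_⟩
    simp only [Finset.mem_insert, Finset.mem_erase, not_or, not_and] at hj
    simp [hsupp j (hj.2 hjm) hj.1]
  · obtain ⟨γ, hγ, hγm, hγs⟩ := hS m (hm.2 hmk)
    refine ⟨_, add_smul_mem_kernel hγ hc (-(γ k / c k)), ?_, fun j hj hjm => ?_⟩
    · simp [hγm, hsupp m (hm.2 hmk) hm.1]
    · simp only [Finset.mem_insert, Finset.mem_erase, not_or, not_and] at hj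
      by_cases hjk : j = k
      · subst hjk
        field_simp
        ring
      · simp [hγs j (hj.2 hjk) hjm, hsupp j (hj.2 hjk) hj.1]

/-! ### Unimodular cones and normality -/

/-- Pivoting along circuits with a square-free side enlarges the lattice of the simplicial cone
containing `x` until it is the whole lattice. -/
lemma exists_unimodular_cone (hnonneg : ∀ i j, 0 ≤ v i j) (hne : ∀ i, v i ≠ 0)
    (hsq : ∀ c, IsCircuit v c → (∀ i, c i ≤ 1) ∨ (∀ i, -1 ≤ c i)) {x : Fin n → ℤ}
    {S₀ : Finset (Fin q)} (hx : InCone v x S₀) :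
    ∃ S, ColIndep v S ∧ InCone v x S ∧ ∀ i, v i ∈ Submodule.span ℤ (v '' S) := by
  classical
  obtain ⟨S₁, hS₁, l, hl0, hlS, hlx⟩ := hx.exists_indep
  obtain ⟨S₂, h12, hS₂, hS₂'⟩ := hS₁.exists_superset_spans
  obtain ⟨S, ⟨hI, hS, hxS⟩, hmax⟩ := Set.Finite.exists_maximalFor
    (fun S : Finset (Fin q) => Submodule.span ℤ (v '' (S : Set (Fin q))))
    {S | ColIndep v S ∧ ColSpans v S ∧ InCone v x S} (Set.toFinite _)
    ⟨S₂, hS₂, hS₂', l, hl0, fun i hi => hlS i fun h => hi (h12 h), hlx⟩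
  refine ⟨S, hI, hxS, fun i => ?_⟩
  by_contra hvi
  have hiS : i ∉ S := fun h => hvi (Submodule.subset_span ⟨i, h, rfl⟩)
  obtain ⟨γ, hγ, hγi, hγs⟩ := hS i hiS
  obtain ⟨c, hc, hcp, hcn⟩ := exists_conformal_circuit hγ
    (fun h => by simp [h] at hγi)
  have hc0 : ∑ i, c i • v i = 0 := intCast_mem_kernel_iff.1 hc.2.1
  have hcs : ∀ j ∉ S, j ≠ i → c j = 0 := fun j hj hji =>
    le_antisymm (hcn j (hγs j hj hji).le) (hcp j (hγs j hj hji).ge)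
  have hci : 0 < c i := by
    refine lt_of_le_of_ne (hcp i (by simp [hγi])) fun h => hc.1 ?_
    have := hI _ hc.2.1 (fun j hj => by
      by_cases hji : j = i
      · simp [hji, ← h]
      · simp [hcs j hj hji])
    funext j
    simpa using congrFun this j
  -- So `c i ≥ 2`: the positive side is not square-free, and the negative one must be.
  have hci1 : c i ≠ 1 := fun h => hvi (mem_span_of_relation hc0 (by simp [h]) hcs)
  have hge : ∀ j, -1 ≤ c j := (hsq c hc).resolve_left fun h => by
    have := h i
    omega
  obtain ⟨k₁, hk₁⟩ := exists_neg_of_sum_smul_eq_zero hnonneg hne hc0 hc.1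
  obtain ⟨l, hl0, hlS, hlx⟩ := hxS
  -- The leaving column minimises `l` among the entries -1 of `c`, so `l + l k • c` stays
  -- non-negative and vanishes at `k`.
  obtain ⟨k, hk, hmin⟩ := Finset.exists_min_image (Finset.univ.filter fun k => c k < 0) l
    ⟨k₁, by simpa using hk₁⟩
  simp only [Finset.mem_filter, Finset.mem_univ, true_and] at hk hmin
  have hck : c k = -1 := by
    have := hge k
    omega
  have hki : k ≠ i := by
    rintro rfl
    omega
  have hkS : k ∈ S := by
    by_contra h
    have := hcs k h hki
    omega
  have hcsq : ∀ j ∉ S, j ≠ i → (c j : ℚ) = 0 := fun j hj hji => by simp [hcs j hj hji]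
  have hckq : (c k : ℚ) ≠ 0 := by simp [hck]
  have hciq : (c i : ℚ) ≠ 0 := by exact_mod_cast hci.ne'
  have hcone : InCone v x (insert i (S.erase k)) := by
    refine ⟨fun j => l j + l k * c j, fun j => ?_, fun j hj => ?_, fun j => ?_⟩
    · rcases le_or_gt 0 (c j) with h | h
      · have : (0 : ℝ) ≤ c j := by exact_mod_cast h
        exact add_nonneg (hl0 j) (mul_nonneg (hl0 k) this)
      · have h1 : c j = -1 := by
          have := hge j
          omega
        have := hmin j h
        simp [h1, this]
    · simp only [Finset.mem_insert, Finset.mem_erase, not_or, not_and] at hj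
      by_cases hjk : j = k
      · simp [hjk, hck]
      · simp [hlS j (hj.2 hjk), hcs j (hj.2 hjk) hj.1]
    · have hcj : ∑ i, (c i : ℝ) * (v i j : ℝ) = 0 := by
        have := congrFun hc0 j
        simp only [Finset.sum_apply, Pi.smul_apply, smul_eq_mul, Pi.zero_apply] at this
        exact_mod_cast this
      simp only [add_mul, Finset.sum_add_distrib, mul_assoc, ← Finset.mul_sum]
      rw [hlx j, hcj]
      simp
  refine hvi (hmax ⟨hI.exchange hc.2.1 hiS hkS hciq hckq hcsq,
    hS.exchange hc.2.1 hkS hckq hcsq, hcone⟩ ?_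
    (Submodule.subset_span ⟨i, by simp, rfl⟩))
  -- The old lattice lies in the new one: only `v k` was dropped, and it is recovered from `c k =
  -- -1`.
  refine Submodule.span_le.2 ?_
  rintro _ ⟨j, hj, rfl⟩
  by_cases hjk : j = k
  · subst hjk
    refine mem_span_of_relation hc0 (by simp [hck]) fun m hm hmj => ?_
    simp only [Finset.mem_insert, Finset.mem_erase, not_or, not_and] at hm
    exact hcs m (hm.2 hmj) hm.1
  · exact Submodule.subset_span ⟨j, by simpa [hjk] using Or.inr hj, rfl⟩

/-- If every circuit has a square-free side, the configuration is normal. -/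
lemma isNormal_of_squarefree_circuits (hnonneg : ∀ i j, 0 ≤ v i j) (hne : ∀ i, v i ≠ 0)
    (hsq : ∀ c, IsCircuit v c → (∀ i, c i ≤ 1) ∨ (∀ i, -1 ≤ c i)) : IsNormal v := by
  classical
  ext x
  constructor
  · intro hx
    refine ⟨AddSubgroup.le_closure_toAddSubmonoid _ hx, ?_⟩
    induction hx using AddSubmonoid.closure_induction with
    | mem y hy =>
      obtain ⟨i, rfl⟩ := hy
      exact Submodule.subset_span ⟨i, rfl⟩
    | zero =>
      have : toReal (0 : Fin n → ℤ) = 0 := by funext j; simp [toReal]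
      rw [this]
      exact Submodule.zero_mem _
    | add y z _ _ hy hz =>
      have : toReal (y + z) = toReal y + toReal z := by funext j; simp [toReal]
      rw [this]
      exact Submodule.add_mem _ hy hz
  · rintro ⟨hxZ, hxR⟩
    obtain ⟨l, hl⟩ := (Submodule.mem_span_range_iff_exists_fun _).1 hxR
    have hcone : InCone v x Finset.univ := by
      refine ⟨fun i => l i, fun i => (l i).2, by simp, fun j => ?_⟩
      have := congrFun hl j
      simp only [Finset.sum_apply, Pi.smul_apply, toReal] at this
      rw [← this]
      rfl
    obtain ⟨S, hS, ⟨m, hm0, hmS, hmx⟩, hspan⟩ := exists_unimodular_cone hnonneg hne hsq hcone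
    have hxS : x ∈ Submodule.span ℤ (v '' S) := by
      have hle : AddSubgroup.closure (Set.range v) ≤
          (Submodule.span ℤ (v '' (S : Set (Fin q)))).toAddSubgroup := by
        rw [AddSubgroup.closure_le]
        rintro _ ⟨i, rfl⟩
        exact hspan i
      exact hle hxZ
    obtain ⟨z, hz⟩ := (Submodule.mem_span_image_finset_iff_exists_fun ℤ).1 hxS
    let y : Fin q → ℤ := fun i => if h : i ∈ S then z ⟨i, h⟩ else 0
    have hyx : ∑ i, y i • v i = x := by
      rw [← hz, ← Finset.sum_subset (Finset.subset_univ S)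
        (fun i _ hi => by simp [y, hi]), ← Finset.sum_coe_sort]
      exact Finset.sum_congr rfl fun i _ => by simp [y]
    -- Real and integral coefficients of `x` on the independent set `S` coincide.
    have hmy : (fun i => m i - (y i : ℝ)) = 0 := by
      refine hS.eq_zero_of_real (fun i hi => by simp [hmS i hi, y, hi]) fun j => ?_
      have : ∑ i, (y i : ℝ) * (v i j : ℝ) = x j := by
        have := congrFun hyx j
        simp only [Finset.sum_apply, Pi.smul_apply, smul_eq_mul] at this
        exact_mod_cast this
      simp only [sub_mul, Finset.sum_sub_distrib]
      rw [hmx j, this, sub_self]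
    have hy0 : ∀ i, 0 ≤ y i := by
      intro i
      have h1 : m i - (y i : ℝ) = 0 := congrFun hmy i
      have h2 : (0 : ℝ) ≤ y i := by linarith [hm0 i]
      exact_mod_cast h2
    rw [← hyx]
    refine AddSubmonoid.sum_mem _ fun i _ => ?_
    obtain ⟨k, hk⟩ := Int.eq_ofNat_of_zero_le (hy0 i)
    rw [hk, natCast_zsmul]
    exact AddSubmonoid.nsmul_mem _ (AddSubmonoid.subset_closure (Set.mem_range_self i)) k

end ToricCircuits

theorem corollary2p8 {K : Type*} [Field K] {n q : ℕ} (v : Fin q → Fin n → ℤ)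
    (hnonneg : ∀ i j, 0 ≤ v i j) (hne : ∀ i, v i ≠ 0)
    (hhom : ToricCircuits.IsHomogeneous v)
    (hcirc : ∀ f : MvPolynomial (Fin q) K,
      ToricCircuits.IsToricCircuit v f → ToricCircuits.HasSquarefreeTerm f) :
    ToricCircuits.IsNormal v ∧
      ∃ s : Finset (MvPolynomial (Fin q) K),
        (∀ f ∈ s, ToricCircuits.IsToricCircuit v f ∧ ToricCircuits.HasSquarefreeTerm f) ∧
        ToricCircuits.toricIdeal K v = Ideal.span (s : Set (MvPolynomial (Fin q) K)) := by
  have hsq : ∀ c, ToricCircuits.IsCircuit v c → (∀ i, c i ≤ 1) ∨ (∀ i, -1 ≤ c i) :=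
    fun c hc => ToricCircuits.squarefree_side (hcirc _ ⟨c, hc, rfl⟩)
  refine ⟨ToricCircuits.isNormal_of_squarefree_circuits hnonneg hne hsq, ?_⟩
  -- By noetherianity, finitely many of the circuits already generate the ideal.
  obtain ⟨s, hs, hspan⟩ := (Submodule.fg_span_iff_fg_span_finset_subset (R := MvPolynomial (Fin q) K)
    {f : MvPolynomial (Fin q) K | ToricCircuits.IsToricCircuit v f}).1 (IsNoetherian.noetherian _)
  exact ⟨s, fun f hf => ⟨hs hf, hcirc f (hs hf)⟩,
    (ToricCircuits.toricIdeal_eq_span_circuits hnonneg hne hsq).trans hspan⟩
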